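/- For $\theta_1,\theta_2,\theta_3\in\mathbb{R}$ let $\Theta=(\theta_1,\theta_2,\theta_3)^{T}$ (the case $m=1$, $n=3$ of simultaneous approximation) and, for $t\ge 1$, put $$\psi_\Theta(t)=\min_{x\in\mathbb{Z},\ 0<|x|\le t}\ \max_{1\le j\le 3}\|\theta_j x\|,$$ where $\|\cdot\|$ is the distance to the nearest integer. Let the uniform exponent $\alpha(\Theta)$ and the individual exponent $\beta(\Theta)\in(0,+\infty]$ be the suprema $$\alpha(\Theta)=\sup\{\gamma>0:\ \limsup_{t\to+\infty}t^\gamma\psi_\Theta(t)<+\infty\},\qquad \beta(\Theta)=\sup\{\gamma>0:\ \liminf_{t\to+\infty}t^\gamma\psi_\Theta(t)<+\infty\}.$$ For $\alpha>0$ put $$g_1(\alpha)=\frac{\alpha(1-\alpha)+\sqrt{\alpha^2(1-\alpha)^2+4\alpha(2\alpha^2-2\alpha+1)}}{2(2\alpha^2-2\alpha+1)};$$ this is the largest root of the equation $(2\alpha^2-2\alpha+1)x^2+\alpha(\alpha-1)x-\alpha=0$. **Theorem 2.** Suppose that $1,\theta_1,\theta_2,\theta_3$ are linearly independent over $\mathbb{Z}$.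 Then $\psi_\Theta(t)>0$ for all $t\ge1$, $\ \tfrac13\le\alpha(\Theta)\le1$, and $$\beta(\Theta)\ \ge\ \alpha(\Theta)\,g_1(\alpha(\Theta)).$$ This improves Jarník's bound $\beta(\Theta)\ge\alpha(\Theta)^2/(1-\alpha(\Theta))$ for $1/3<\alpha(\Theta)<\alpha_0$: the equation $x^3-x^2+2x-1=0$ has a unique real root $\alpha_0$, one has $1/3<\alpha_0<1$, and $\alpha\,g_1(\alpha)>\alpha^2/(1-\alpha)$ whenever $1/3<\alpha<\alpha_0$. -/

import Mathlib

noncomputable section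

namespace Diophantine

/-- The linear form `L_j(x) = ∑ i, θ_j^i x_i` at an integer vector `x`. -/
def linForm {n m : ℕ} (Θ : Matrix (Fin n) (Fin m) ℝ) (j : Fin n) (x : Fin m → ℤ) : ℝ :=
  ∑ i, Θ j i * (x i : ℝ)

/-- The distance from a real number to the nearest integer. -/
def distInt (r : ℝ) : ℝ := |r - (round r : ℝ)|

/-- `ζ(x) = max_j ‖L_j(x)‖`, where `‖·‖` is the distance to the nearest integer.
The norm on `Fin n → ℝ` is the maximum norm. -/
def zeta {n m : ℕ} (Θ : Matrix (Fin n) (Fin m) ℝ) (x : Fin m → ℤ) : ℝ :=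
  ‖fun j : Fin n => distInt (linForm Θ j x)‖

/-- `ψ_Θ(t)`, the minimum of `ζ(x)` over the integer vectors with `0 < max_i |x_i| ≤ t`.
The norm on `Fin m → ℤ` is the maximum norm, and the set of admissible vectors is finite and, for
`t ≥ 1` and `m ≥ 1`, non-empty, so that the infimum is a minimum. -/
def psi {n m : ℕ} (Θ : Matrix (Fin n) (Fin m) ℝ) (t : ℝ) : ℝ :=
  sInf (zeta Θ '' {x : Fin m → ℤ | 0 < ‖x‖ ∧ ‖x‖ ≤ t})

/-- The uniform exponent `α(Θ)`, as an extended real number. -/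
def uniformExponent {n m : ℕ} (Θ : Matrix (Fin n) (Fin m) ℝ) : EReal :=
  sSup ((fun γ : ℝ => (γ : EReal)) '' {γ : ℝ | 0 < γ ∧
    Filter.limsup (fun t : ℝ => ((t ^ γ * psi Θ t : ℝ) : EReal)) Filter.atTop < ⊤})

/-- The individual exponent `β(Θ)`, as an extended real number. -/
def individualExponent {n m : ℕ} (Θ : Matrix (Fin n) (Fin m) ℝ) : EReal :=
  sSup ((fun γ : ℝ => (γ : EReal)) '' {γ : ℝ | 0 < γ ∧
    Filter.liminf (fun t : ℝ => ((t ^ γ * psi Θ t : ℝ) : EReal)) Filter.atTop < ⊤})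

/-- The function `g₁`. -/
def g1 (a : ℝ) : ℝ :=
  (a * (1 - a) + √(a ^ 2 * (1 - a) ^ 2 + 4 * a * (2 * a ^ 2 - 2 * a + 1))) /
    (2 * (2 * a ^ 2 - 2 * a + 1))

end Diophantine

end

namespace Diophantine

/-! ### The function `g1` -/

/-! Let X_n be the denominators of the best approximations and d_n their distances. A uniform bound
with exponent a < α gives d_n ≤ X_{n+1}^(-a), so β ≥ a g follows once X_{n+1} > X_n^g infinitely
often (`mul_le_individualExponent`).

Suppose X_{n+1} ≤ X_n^g from some index on. By independence of 1, θ₁, θ₂, θ₃, three consecutive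
approximation vectors in ℤ⁴ are independent infinitely often. Their 3 × 3 minors give an integer
form vanishing on them, whose coefficients at the θ-coordinates are at most M = 6 X_{n+2} d_n
d_{n+1} (`exists_normal_or_dependent`, `exists_normal`). The form cannot vanish at all later
vectors. If i + 1 is the first index where it does not, then X_i ≤ 6 M d_i X_{i+1}
(`le_of_evalAt_eq_zero`, `exists_gap`). Inserting the bounds on d and on the growth of X contradicts
(1 - a) g² < a (g + 1) (`exists_rpow_lt`).

For 1/3 ≤ a ≤ 1 this inequality holds for all 0 < g < g₁(a) (`quadratic_lt_of_lt_g1`), and letting a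
→ α, g → g₁(α) gives the bound. -/

theorem g1_denom_pos (a : ℝ) : 0 < 2 * a ^ 2 - 2 * a + 1 := by
  nlinarith [sq_nonneg (2 * a - 1)]

theorem g1_root {a : ℝ} (ha : 0 < a) :
    (2 * a ^ 2 - 2 * a + 1) * g1 a ^ 2 + a * (a - 1) * g1 a - a = 0 := by
  have hA := g1_denom_pos a
  have hD : 0 ≤ a ^ 2 * (1 - a) ^ 2 + 4 * a * (2 * a ^ 2 - 2 * a + 1) := by positivity
  have hs := Real.sq_sqrt hD
  unfold g1
  set s := √(a ^ 2 * (1 - a) ^ 2 + 4 * a * (2 * a ^ 2 - 2 * a + 1))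
  generalize 2 * a ^ 2 - 2 * a + 1 = A at *
  field_simp
  linear_combination hs

theorem g1_pos {a : ℝ} (ha : 0 < a) : 0 < g1 a := by
  have hA := g1_denom_pos a
  have hlt : |a * (1 - a)| < √(a ^ 2 * (1 - a) ^ 2 + 4 * a * (2 * a ^ 2 - 2 * a + 1)) := by
    apply Real.lt_sqrt_of_sq_lt
    rw [sq_abs, mul_pow]
    have : 0 < 4 * a * (2 * a ^ 2 - 2 * a + 1) := by positivity
    linarith
  have := neg_abs_le (a * (1 - a))
  exact div_pos (by linarith) (by linarith)

/-- The leading coefficient is positive and the product of the roots is negative, so the quadratic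
is positive beyond its positive root `g1 a`. -/
theorem le_g1_of_quadratic_nonpos {a x : ℝ} (ha : 0 < a)
    (hx : (2 * a ^ 2 - 2 * a + 1) * x ^ 2 + a * (a - 1) * x - a ≤ 0) : x ≤ g1 a := by
  have hA := g1_denom_pos a
  have hr := g1_root ha
  have hg := g1_pos ha
  by_contra! h
  generalize 2 * a ^ 2 - 2 * a + 1 = A at *
  have hpos : 0 < A * g1 a + a * (a - 1) := by
    have : 0 < g1 a * (A * g1 a + a * (a - 1)) := by nlinarith
    exact pos_of_mul_pos_right this hg.le
  have : 0 < (x - g1 a) * (A * x + (A * g1 a + a * (a - 1))) :=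
    mul_pos (by linarith) (by have := mul_pos hA (hg.trans h); linarith)
  nlinarith

theorem isGreatest_g1 {a : ℝ} (ha : 0 < a) :
    IsGreatest {x : ℝ | (2 * a ^ 2 - 2 * a + 1) * x ^ 2 + a * (a - 1) * x - a = 0} (g1 a) :=
  ⟨g1_root ha, fun _ hx => le_g1_of_quadratic_nonpos ha (le_of_eq hx)⟩

theorem one_le_g1 {a : ℝ} (h3 : 1 / 3 ≤ a) (h1 : a ≤ 1) : 1 ≤ g1 a :=
  le_g1_of_quadratic_nonpos (by linarith) (by nlinarith)

/-- Links `g1` to the condition that the Diophantine argument needs. The weak inequality is checked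
at `g1 a` by eliminating its square with the quadratic equation, which is where 1/3 ≤ a enters. It
becomes strict below `g1 a` because (x + 1) / x ^ 2 decreases. -/
theorem quadratic_lt_of_lt_g1 {a g : ℝ} (h3 : 1 / 3 ≤ a) (h1 : a ≤ 1) (hg : 0 < g)
    (hlt : g < g1 a) : (1 - a) * g ^ 2 < a * (g + 1) := by
  have ha : 0 < a := by linarith
  have hA := g1_denom_pos a
  have hr := g1_root ha
  have hone := one_le_g1 h3 h1
  have hmax : (1 - a) * g1 a ^ 2 ≤ a * (g1 a + 1) := by
    have h : 0 ≤ (2 * a ^ 2 - 2 * a + 1) * (a * (g1 a + 1) - (1 - a) * g1 a ^ 2) := by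
      have h2 : (2 * a ^ 2 - 2 * a + 1) * (a * (g1 a + 1) - (1 - a) * g1 a ^ 2)
          = a ^ 2 * (a * (g1 a - 1) + (3 * a - 1)) := by
        linear_combination -(1 - a) * hr
      rw [h2]
      have : 0 ≤ a * (g1 a - 1) := mul_nonneg ha.le (by linarith)
      exact mul_nonneg (by positivity) (by linarith)
    linarith [nonneg_of_mul_nonneg_right h hA]
  have h : 0 < g1 a * (a * (g + 1) - (1 - a) * g ^ 2) := by
    have h1' : 0 ≤ g * (a * (g1 a + 1) - (1 - a) * g1 a ^ 2) := mul_nonneg hg.le (by linarith)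
    have h2' : 0 < a * (g1 a - g) := mul_pos ha (by linarith)
    have h3' : 0 ≤ (1 - a) * (g1 a * g * (g1 a - g)) :=
      mul_nonneg (by linarith) (mul_nonneg (mul_nonneg (by linarith) hg.le) (by linarith))
    nlinarith
  linarith [pos_of_mul_pos_right h (by linarith : (0:ℝ) ≤ g1 a)]

theorem strictMono_cubic : StrictMono fun x : ℝ => x ^ 3 - x ^ 2 + 2 * x - 1 := by
  intro x y hxy
  have : 0 < (y - x) * ((y ^ 2 + x * y + x ^ 2) - (x + y) + 2) :=
    mul_pos (by linarith) (by nlinarith [sq_nonneg (x + y - 1), sq_nonneg (x + y), sq_nonneg (x - y)])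
  simp only
  nlinarith

/-- Inserting a / (1 - a) into the quadratic leaves a positive multiple of the cubic, so the sign of
the cubic decides the comparison. -/
theorem div_lt_mul_g1 {a : ℝ} (ha : 0 < a) (h1 : a < 1)
    (hc : a ^ 3 - a ^ 2 + 2 * a - 1 < 0) : a ^ 2 / (1 - a) < a * g1 a := by
  have hb : 0 < 1 - a := by linarith
  have hlt : (2 * a ^ 2 - 2 * a + 1) * (a / (1 - a)) ^ 2 + a * (a - 1) * (a / (1 - a)) - a < 0 := by
    have : (2 * a ^ 2 - 2 * a + 1) * (a / (1 - a)) ^ 2 + a * (a - 1) * (a / (1 - a)) - a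
        = a * (a ^ 3 - a ^ 2 + 2 * a - 1) / (1 - a) ^ 2 := by
      field_simp
      ring
    rw [this]
    exact div_neg_of_neg_of_pos (mul_neg_of_pos_of_neg ha hc) (by positivity)
  have hle := le_g1_of_quadratic_nonpos ha hlt.le
  have hne : a / (1 - a) ≠ g1 a := by
    intro h
    rw [h, g1_root ha] at hlt
    exact lt_irrefl _ hlt
  calc a ^ 2 / (1 - a) = a * (a / (1 - a)) := by ring
    _ < a * g1 a := mul_lt_mul_of_pos_left (lt_of_le_of_ne hle hne) ha

theorem exists_cubic_root : ∃ α₀ : ℝ, (∀ x : ℝ, x ^ 3 - x ^ 2 + 2 * x - 1 = 0 ↔ x = α₀) ∧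
    1 / 3 < α₀ ∧ α₀ < 1 ∧ ∀ a : ℝ, 1 / 3 < a → a < α₀ → a ^ 2 / (1 - a) < a * g1 a := by
  have hmono := strictMono_cubic
  obtain ⟨r, -, hr⟩ := intermediate_value_Icc (by norm_num : (1 / 3 : ℝ) ≤ 1)
    (f := fun x : ℝ => x ^ 3 - x ^ 2 + 2 * x - 1) (by fun_prop)
    (show (0 : ℝ) ∈ _ by norm_num)
  have h1 : r < 1 := hmono.lt_iff_lt.mp (by simp only at hr ⊢; rw [hr]; norm_num)
  refine ⟨r, fun x => ⟨fun hx => hmono.injective (hx.trans hr.symm), fun hx => hx ▸ hr⟩,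
    hmono.lt_iff_lt.mp (by simp only at hr ⊢; rw [hr]; norm_num), h1, fun a ha har => ?_⟩
  exact div_lt_mul_g1 (by linarith) (har.trans h1) (by simpa only [hr] using hmono har)

/-! ### Sequences of successive minima -/

/-- A function on the positive integers without a smallest value has a sequence of record minima. -/
theorem exists_record_sequence {z : ℕ → ℝ} (hz : ∀ q, 1 ≤ q → ∃ r, q < r ∧ z r < z q) :
    ∃ X : ℕ → ℕ, X 0 = 1 ∧ StrictMono X ∧ (∀ n, z (X (n + 1)) < z (X n)) ∧
      ∀ n q, 1 ≤ q → q < X (n + 1) → z (X n) ≤ z q := by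
  classical
  have hex : ∀ q : {q : ℕ // 1 ≤ q}, ∃ r : {q : ℕ // 1 ≤ q}, (q : ℕ) < r ∧ z r < z q ∧
      ∀ s, (q : ℕ) < s → s < r → z q ≤ z s := by
    rintro ⟨q, hq⟩
    have h := hz q hq
    obtain ⟨h1, h2⟩ := Nat.find_spec h
    exact ⟨⟨Nat.find h, hq.trans h1.le⟩, h1, h2, fun s hs hs' =>
      not_lt.mp fun hlt => Nat.find_min h hs' ⟨hs, hlt⟩⟩
  choose f hf using hex
  let Y : ℕ → {q : ℕ // 1 ≤ q} := fun n => f^[n] ⟨1, le_rfl⟩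
  have hY : ∀ n, Y (n + 1) = f (Y n) := fun n => Function.iterate_succ_apply' f n _
  refine ⟨fun n => Y n, rfl, strictMono_nat_of_lt_succ fun n => ?_, fun n => ?_, fun n => ?_⟩
  · rw [hY]; exact (hf _).1
  · simp only [hY]; exact (hf _).2.1
  · have key : ∀ n q, (Y n : ℕ) ≤ q → q < Y (n + 1) → z (Y n) ≤ z q := by
      intro n q h1 h2
      rcases h1.eq_or_lt with h | h
      · rw [h]
      · rw [hY] at h2
        exact (hf _).2.2 q h h2
    induction n with
    | zero => exact fun q h1 h2 => key 0 q h1 h2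
    | succ n ih =>
      intro q h1 h2
      rcases lt_or_ge q (Y (n + 1)) with h | h
      · refine le_trans ?_ (ih q h1 h)
        simp only [hY]; exact (hf _).2.1.le
      · exact key _ q h h2

/-! ### The function `psi` for simultaneous approximation to three numbers -/

/-- The largest distance of `θ j * q` to the nearest integer. -/
noncomputable def dist3 (θ : Fin 3 → ℝ) (q : ℕ) : ℝ := ‖fun j => distInt (θ j * q)‖

theorem zeta_eq_dist3 (θ : Fin 3 → ℝ) (x : Fin 1 → ℤ) :
    zeta !![θ 0; θ 1; θ 2] x = dist3 θ (x 0).natAbs := by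
  have hneg : ∀ r : ℝ, distInt (-r) = distInt r := by
    intro r
    apply le_antisymm
    · calc distInt (-r) ≤ |(-r) - ((-round r : ℤ) : ℝ)| := round_le _ _
        _ = distInt r := by rw [distInt, ← abs_neg]; push_cast; ring_nf
    · calc distInt r ≤ |r - ((-round (-r) : ℤ) : ℝ)| := round_le _ _
        _ = distInt (-r) := by rw [distInt, ← abs_neg]; push_cast; ring_nf
  unfold zeta dist3
  congr 1
  funext j
  have hl : linForm !![θ 0; θ 1; θ 2] j x = θ j * (x 0 : ℝ) := by
    fin_cases j <;> simp [linForm]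
  rw [hl]
  rcases Int.natAbs_eq (x 0) with h | h
  · rw [h]; simp
  · rw [h]; simp [hneg]

theorem norm_fin_one (x : Fin 1 → ℤ) : ‖x‖ = ((x 0).natAbs : ℝ) := by
  have : ‖x‖ = ‖x 0‖ := by
    have hx : x = fun _ => x 0 := funext fun i => by rw [Subsingleton.elim i 0]
    conv_lhs => rw [hx]
    exact pi_norm_const (x 0)
  rw [this, Int.norm_eq_abs, Nat.cast_natAbs, Int.cast_abs]

theorem dist3_nonneg (θ : Fin 3 → ℝ) (q : ℕ) : 0 ≤ dist3 θ q := norm_nonneg _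

theorem abs_sub_round_le_dist3 (θ : Fin 3 → ℝ) (q : ℕ) (j : Fin 3) :
    |θ j * q - round (θ j * q)| ≤ dist3 θ q := by
  have := norm_le_pi_norm (fun j => distInt (θ j * q)) j
  rwa [Real.norm_eq_abs, distInt, abs_abs] at this

theorem psi_le_dist3 (θ : Fin 3 → ℝ) {q : ℕ} {t : ℝ} (hq : 1 ≤ q) (hqt : (q : ℝ) ≤ t) :
    psi !![θ 0; θ 1; θ 2] t ≤ dist3 θ q := by
  refine csInf_le ⟨0, ?_⟩ ⟨fun _ => (q : ℤ), ?_, ?_⟩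
  · rintro _ ⟨x, -, rfl⟩
    exact norm_nonneg _
  · rw [Set.mem_ofPred_eq, norm_fin_one, Int.natAbs_natCast]
    exact ⟨by exact_mod_cast hq, hqt⟩
  · rw [zeta_eq_dist3, Int.natAbs_natCast]

theorem le_psi (θ : Fin 3 → ℝ) {c t : ℝ} (ht : 1 ≤ t)
    (h : ∀ q : ℕ, 1 ≤ q → (q : ℝ) ≤ t → c ≤ dist3 θ q) : c ≤ psi !![θ 0; θ 1; θ 2] t := by
  refine le_csInf ⟨_, fun _ => 1, ?_, rfl⟩ ?_
  · rw [Set.mem_ofPred_eq, norm_fin_one]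
    simpa using ht
  · rintro _ ⟨x, hx, rfl⟩
    rw [Set.mem_ofPred_eq, norm_fin_one] at hx
    rw [zeta_eq_dist3]
    exact h _ (by exact_mod_cast hx.1) hx.2

theorem psi_nonneg (θ : Fin 3 → ℝ) {t : ℝ} (ht : 1 ≤ t) : 0 ≤ psi !![θ 0; θ 1; θ 2] t :=
  le_psi θ ht fun q _ _ => dist3_nonneg θ q

/-- Linear independence of `1, θ 0, θ 1, θ 2` over the integers. -/
def Independent3 (θ : Fin 3 → ℝ) : Prop :=
  ∀ (u₀ : ℤ) (u : Fin 3 → ℤ), (u₀ : ℝ) + ∑ j, u j * θ j = 0 → u₀ = 0 ∧ u = 0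

theorem independent3_of_linearIndependent {θ₁ θ₂ θ₃ : ℝ}
    (h : LinearIndependent ℤ ![1, θ₁, θ₂, θ₃]) : Independent3 ![θ₁, θ₂, θ₃] := by
  intro u₀ u hu
  have := Fintype.linearIndependent_iff.mp h ![u₀, u 0, u 1, u 2] (by
    simp [Fin.sum_univ_succ] at hu ⊢
    linarith)
  refine ⟨this 0, funext fun j => ?_⟩
  fin_cases j
  · exact this 1
  · exact this 2
  · exact this 3

theorem dist3_pos {θ : Fin 3 → ℝ} (hθ : Independent3 θ) {q : ℕ} (hq : 1 ≤ q) :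
    0 < dist3 θ q := by
  refine lt_of_le_of_ne (dist3_nonneg θ q) fun h => ?_
  have h0 := abs_sub_round_le_dist3 θ q 0
  rw [← h] at h0
  have h1 := abs_nonpos_iff.mp h0
  have := (hθ (-round (θ 0 * q)) ![q, 0, 0] (by
    simp [Fin.sum_univ_succ]
    linarith)).2
  have h2 : (q : ℤ) = 0 := congrFun this 0
  omega

theorem psi_pos {θ : Fin 3 → ℝ} (hθ : Independent3 θ) {t : ℝ} (ht : 1 ≤ t) :
    0 < psi !![θ 0; θ 1; θ 2] t := by
  obtain ⟨q, hq, hmin⟩ := Finset.exists_min_image (Finset.Icc 1 ⌊t⌋₊) (dist3 θ)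
    ⟨1, by simp [ht]⟩
  rw [Finset.mem_Icc] at hq
  exact (dist3_pos hθ hq.1).trans_le (le_psi θ ht fun r hr hrt =>
    hmin r (Finset.mem_Icc.mpr ⟨hr, Nat.le_floor hrt⟩))

/-- Dirichlet's theorem on simultaneous approximation to three numbers. -/
theorem exists_dist3_le (θ : Fin 3 → ℝ) {N : ℕ} (hN : 1 ≤ N) :
    ∃ q : ℕ, 1 ≤ q ∧ q ≤ N ^ 3 ∧ dist3 θ q ≤ 1 / N := by
  have hN0 : (0 : ℝ) < N := by exact_mod_cast hN
  let f : ℕ → Fin 3 → ℕ := fun q j => ⌊(N : ℝ) * Int.fract (θ j * q)⌋₊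
  have hmaps : ∀ q ∈ Finset.range (N ^ 3 + 1), f q ∈ Fintype.piFinset fun _ : Fin 3 =>
      Finset.range N := by
    intro q _
    rw [Fintype.mem_piFinset]
    intro j
    rw [Finset.mem_range, Nat.floor_lt (by positivity)]
    exact mul_lt_of_lt_one_right hN0 (Int.fract_lt_one _)
  -- Pigeonhole: N ^ 3 + 1 multipliers fall into N ^ 3 boxes of fractional parts.
  obtain ⟨a, ha, b, hb, hab, hf⟩ := Finset.exists_ne_map_eq_of_card_lt_of_maps_to
    (by simp) hmaps
  wlog hlt : a < b generalizing a b
  · exact this b hb a ha hab.symm hf.symm (by omega)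
  rw [Finset.mem_range] at hb
  refine ⟨b - a, by omega, by omega, (pi_norm_le_iff_of_nonneg (by positivity)).mpr fun j => ?_⟩
  rw [Real.norm_eq_abs, distInt, abs_abs]
  refine (round_le _ (⌊θ j * b⌋ - ⌊θ j * a⌋)).trans ?_
  have hj : ⌊(N : ℝ) * Int.fract (θ j * a)⌋₊ = ⌊(N : ℝ) * Int.fract (θ j * b)⌋₊ := congrFun hf j
  have e : θ j * ((b - a : ℕ) : ℝ) - ((⌊θ j * b⌋ - ⌊θ j * a⌋ : ℤ) : ℝ)
      = Int.fract (θ j * b) - Int.fract (θ j * a) := by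
    rw [Int.fract, Int.fract, Nat.cast_sub hlt.le]
    push_cast
    ring
  rw [e, le_div_iff₀ hN0]
  have a1 := Nat.floor_le (show 0 ≤ (N : ℝ) * Int.fract (θ j * a) by positivity)
  have a2 := Nat.lt_floor_add_one ((N : ℝ) * Int.fract (θ j * a))
  have b1 := Nat.floor_le (show 0 ≤ (N : ℝ) * Int.fract (θ j * b) by positivity)
  have b2 := Nat.lt_floor_add_one ((N : ℝ) * Int.fract (θ j * b))
  rw [hj] at a1 a2
  have hN1 : |Int.fract (θ j * b) - Int.fract (θ j * a)| * N
      = |N * Int.fract (θ j * b) - N * Int.fract (θ j * a)| := by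
    rw [← mul_sub, abs_mul, abs_of_pos hN0, mul_comm]
  rw [hN1, abs_le]
  constructor <;> linarith

theorem exists_dist3_lt (θ : Fin 3 → ℝ) {ε : ℝ} (hε : 0 < ε) : ∃ q : ℕ, 1 ≤ q ∧ dist3 θ q < ε := by
  obtain ⟨n, hn⟩ := exists_nat_one_div_lt hε
  obtain ⟨q, hq, -, h⟩ := exists_dist3_le θ (Nat.le_add_left 1 n)
  exact ⟨q, hq, h.trans_lt (by exact_mod_cast hn)⟩

/-- Dirichlet's theorem with N = ⌊t ^ (1/3)⌋; the constant 2 absorbs the rounding, as s ≤ 2 ⌊s⌋ for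
s ≥ 1. -/
theorem psi_le_of_one_le (θ : Fin 3 → ℝ) {t : ℝ} (ht : 1 ≤ t) :
    t ^ (1 / 3 : ℝ) * psi !![θ 0; θ 1; θ 2] t ≤ 2 := by
  set s := t ^ (1 / 3 : ℝ) with hs
  have hs1 : 1 ≤ s := Real.one_le_rpow ht (by norm_num)
  have hs3 : s ^ 3 = t := by
    rw [hs, ← Real.rpow_natCast, ← Real.rpow_mul (by linarith)]
    norm_num
  have hN : 1 ≤ ⌊s⌋₊ := Nat.le_floor (by simpa using hs1)
  have hN' : (1 : ℝ) ≤ ⌊s⌋₊ := by exact_mod_cast hN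
  obtain ⟨q, hq, hqN, hd⟩ := exists_dist3_le θ hN
  have hqt : (q : ℝ) ≤ t := by
    calc (q : ℝ) ≤ (⌊s⌋₊ : ℝ) ^ 3 := by exact_mod_cast hqN
      _ ≤ s ^ 3 := by gcongr; exact Nat.floor_le (by linarith)
      _ = t := hs3
  have h := (psi_le_dist3 θ hq hqt).trans hd
  have hlt := Nat.lt_floor_add_one s
  calc s * psi !![θ 0; θ 1; θ 2] t ≤ s * (1 / ⌊s⌋₊) := by gcongr
    _ ≤ 2 := by
      rw [mul_one_div, div_le_iff₀ (by linarith)]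
      linarith

/-! ### Integer points close to the line through `(1, θ)` -/

/-- The integer linear form with coefficients `u₀, u` at the point
`(q, round (θ 0 * q), round (θ 1 * q), round (θ 2 * q))`. -/
noncomputable def evalAt (θ : Fin 3 → ℝ) (u₀ : ℤ) (u : Fin 3 → ℤ) (q : ℕ) : ℤ :=
  u₀ * q + ∑ j, u j * round (θ j * q)

theorem evalAt_cast (θ : Fin 3 → ℝ) (u₀ : ℤ) (u : Fin 3 → ℤ) (q : ℕ) :
    (evalAt θ u₀ u q : ℝ) =
      (u₀ + ∑ j, u j * θ j) * q - ∑ j, u j * (θ j * q - round (θ j * q)) := by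
  simp only [evalAt, Fin.sum_univ_three]
  push_cast
  ring

theorem abs_sum_mul_le (θ : Fin 3 → ℝ) {u : Fin 3 → ℤ} {M : ℝ} (hM : ∀ j, |(u j : ℝ)| ≤ M)
    (q : ℕ) : |∑ j, u j * (θ j * q - round (θ j * q))| ≤ 3 * M * dist3 θ q := by
  calc |∑ j, u j * (θ j * q - round (θ j * q))|
      ≤ ∑ j, |u j * (θ j * q - round (θ j * q))| := Finset.abs_sum_le_sum_abs _ _
    _ ≤ ∑ _j : Fin 3, M * dist3 θ q := by
        refine Finset.sum_le_sum fun j _ => ?_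
        rw [abs_mul]
        exact mul_le_mul (hM j) (abs_sub_round_le_dist3 θ q j) (abs_nonneg _)
          ((abs_nonneg _).trans (hM j))
    _ = 3 * M * dist3 θ q := by
        simp [mul_assoc]

/-- If a form vanishes at one point but not at a later and closer one, its coefficients are
large. -/
theorem le_of_evalAt_eq_zero {θ : Fin 3 → ℝ} {u₀ : ℤ} {u : Fin 3 → ℤ} {M : ℝ}
    (hM : ∀ j, |(u j : ℝ)| ≤ M) {q r : ℕ} (hqr : q ≤ r) (hd : dist3 θ r ≤ dist3 θ q)
    (h0 : evalAt θ u₀ u q = 0) (h1 : evalAt θ u₀ u r ≠ 0) :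
    (q : ℝ) ≤ 6 * M * dist3 θ q * r := by
  have hM0 : 0 ≤ M := (abs_nonneg _).trans (hM 0)
  have e0 := evalAt_cast θ u₀ u q
  have e1 := evalAt_cast θ u₀ u r
  rw [h0, Int.cast_zero] at e0
  have hone : (1 : ℝ) ≤ |(evalAt θ u₀ u r : ℝ)| := by exact_mod_cast Int.one_le_abs h1
  have b0 := abs_sum_mul_le θ hM q
  have b1 := abs_sum_mul_le θ hM r
  have hqr' : (q : ℝ) ≤ r := by exact_mod_cast hqr
  set η := (u₀ : ℝ) + ∑ j, u j * θ j
  have hη : |η| * q ≤ 3 * M * dist3 θ q := by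
    rw [← Nat.abs_cast q, ← abs_mul, sub_eq_zero.mp e0.symm]
    exact b0
  rw [e1] at hone
  -- A nonzero integer value at r is at least 1 in absolute value, while `hη` bounds η through the
  -- vanishing at q.
  have h2 : 1 ≤ |η| * r + 3 * M * dist3 θ r := by
    refine hone.trans ((abs_sub _ _).trans ?_)
    rw [abs_mul, Nat.abs_cast]
    linarith
  calc (q : ℝ) ≤ q * (|η| * r + 3 * M * dist3 θ r) := le_mul_of_one_le_right (by positivity) h2
    _ = (|η| * q) * r + q * (3 * M * dist3 θ r) := by ring
    _ ≤ (3 * M * dist3 θ q) * r + r * (3 * M * dist3 θ q) := by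
        have := dist3_nonneg θ r
        gcongr
    _ = 6 * M * dist3 θ q * r := by ring

/-- Two successive points are not proportional. -/
theorem exists_minor_ne_zero {θ : Fin 3 → ℝ} {q r : ℕ} (hq : 1 ≤ q) (hqr : q < r)
    (hd : dist3 θ r < dist3 θ q) :
    ∃ b, (q : ℤ) * round (θ b * r) - r * round (θ b * q) ≠ 0 := by
  by_contra! h
  refine hd.not_ge ((pi_norm_le_iff_of_nonneg (dist3_nonneg θ r)).mpr fun b => ?_)
  rw [Real.norm_eq_abs, distInt, abs_abs]
  have hb : (q : ℝ) * round (θ b * r) - r * round (θ b * q) = 0 := by exact_mod_cast h b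
  have hr : (0 : ℝ) < r := by exact_mod_cast (by omega : 0 < r)
  have hqr' : (q : ℝ) ≤ r := by exact_mod_cast hqr.le
  -- For proportional points the errors scale as q : r, so the later point would not be closer.
  have e : (r : ℝ) * (θ b * q - round (θ b * q)) = q * (θ b * r - round (θ b * r)) := by
    linear_combination hb
  have e' := congrArg abs e
  rw [abs_mul, abs_mul, Nat.abs_cast, Nat.abs_cast] at e'
  refine le_of_mul_le_mul_left ?_ hr
  rw [e']
  exact mul_le_mul hqr' (abs_sub_round_le_dist3 θ r b) (abs_nonneg _) hr.le

/-- A nonzero 2 × 2 minor is an integer of absolute value at least 1; this forces the uniform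
exponent to be at most 1. -/
theorem one_le_two_mul_dist3 {θ : Fin 3 → ℝ} {q r : ℕ} (hq : 1 ≤ q) (hqr : q < r)
    (hd : dist3 θ r < dist3 θ q) : 1 ≤ 2 * r * dist3 θ q := by
  obtain ⟨b, hb⟩ := exists_minor_ne_zero hq hqr hd
  have hone : (1 : ℝ) ≤ |(((q : ℤ) * round (θ b * r) - r * round (θ b * q) : ℤ) : ℝ)| := by
    exact_mod_cast Int.one_le_abs hb
  have e : (((q : ℤ) * round (θ b * r) - r * round (θ b * q) : ℤ) : ℝ)
      = r * (θ b * q - round (θ b * q)) - q * (θ b * r - round (θ b * r)) := by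
    push_cast
    ring
  rw [e] at hone
  have hqr' : (q : ℝ) ≤ r := by exact_mod_cast hqr.le
  refine hone.trans ((abs_sub _ _).trans ?_)
  rw [abs_mul, abs_mul, Nat.abs_cast, Nat.abs_cast]
  calc (r : ℝ) * |θ b * q - round (θ b * q)| + q * |θ b * r - round (θ b * r)|
      ≤ r * dist3 θ q + r * dist3 θ q := by
        gcongr
        · exact abs_sub_round_le_dist3 θ q b
        · exact (abs_sub_round_le_dist3 θ r b).trans hd.le
    _ = 2 * r * dist3 θ q := by ring

/-- The determinant with rows `(p, a, a')`, `(q, b, b')`, `(r, c, c')`. -/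
def det3 {R : Type*} [CommRing R] (p q r a b c a' b' c' : R) : R :=
  p * (b * c' - b' * c) - q * (a * c' - a' * c) + r * (a * b' - a' * b)

theorem abs_det3_le {p q r a b c a' b' c' d₁ d₂ d₃ : ℝ} (hp : 0 ≤ p) (hpq : p ≤ q) (hqr : q ≤ r)
    (h12 : d₂ ≤ d₁) (h23 : d₃ ≤ d₂) (ha : |a| ≤ d₁) (ha' : |a'| ≤ d₁) (hb : |b| ≤ d₂)
    (hb' : |b'| ≤ d₂) (hc : |c| ≤ d₃) (hc' : |c'| ≤ d₃) :
    |det3 p q r a b c a' b' c'| ≤ 6 * r * d₁ * d₂ := by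
  have two : ∀ {x y x' y' X Y : ℝ}, |x| ≤ X → |x'| ≤ X → |y| ≤ Y → |y'| ≤ Y →
      |x * y' - x' * y| ≤ 2 * (X * Y) := by
    intro x y x' y' X Y hx hx' hy hy'
    have hX := (abs_nonneg _).trans hx
    refine (abs_sub _ _).trans ?_
    rw [abs_mul, abs_mul, two_mul]
    gcongr
  have h3 : 0 ≤ d₃ := (abs_nonneg _).trans hc
  have h2 : 0 ≤ d₂ := h3.trans h23
  have h1 : 0 ≤ d₁ := h2.trans h12
  have hq : 0 ≤ q := hp.trans hpq
  have hr : 0 ≤ r := hq.trans hqr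
  calc |det3 p q r a b c a' b' c'|
      ≤ |p * (b * c' - b' * c)| + |q * (a * c' - a' * c)| + |r * (a * b' - a' * b)| :=
        (abs_add_le _ _).trans (add_le_add_left (abs_sub _ _) _)
    _ ≤ r * (2 * (d₁ * d₂)) + r * (2 * (d₁ * d₂)) + r * (2 * (d₁ * d₂)) := by
        rw [abs_mul, abs_mul, abs_mul, abs_of_nonneg hp, abs_of_nonneg hq, abs_of_nonneg hr]
        gcongr
        · exact hpq.trans hqr
        · exact (two hb hb' hc hc').trans (by rw [mul_comm d₁]; gcongr; exact h23.trans h12)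
        · exact (two ha ha' hc hc').trans (by gcongr)
        · exact two ha ha' hb hb'
    _ = 6 * r * d₁ * d₂ := by ring

/-- Three successive points either span a space with a small normal vector, or the third is a
linear combination of the first two. -/
theorem exists_normal_or_dependent {θ : Fin 3 → ℝ} {p q r : ℕ} (hp : 1 ≤ p) (hpq : p < q)
    (hqr : q < r) (h12 : dist3 θ q < dist3 θ p) (h23 : dist3 θ r < dist3 θ q) :
    (∃ (u₀ : ℤ) (u : Fin 3 → ℤ), u ≠ 0 ∧ evalAt θ u₀ u r = 0 ∧
      ∀ j, |(u j : ℝ)| ≤ 6 * r * dist3 θ p * dist3 θ q) ∨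
    ∀ (u₀ : ℤ) (u : Fin 3 → ℤ), evalAt θ u₀ u p = 0 → evalAt θ u₀ u q = 0 →
      evalAt θ u₀ u r = 0 := by
  let A : Fin 3 → ℤ := fun j => round (θ j * p)
  let B : Fin 3 → ℤ := fun j => round (θ j * q)
  let C : Fin 3 → ℤ := fun j => round (θ j * r)
  let D : Fin 3 → Fin 3 → ℤ := fun i k => det3 (p : ℤ) q r (A i) (B i) (C i) (A k) (B k) (C k)
  have hD : ∀ i k, |(D i k : ℝ)| ≤ 6 * r * dist3 θ p * dist3 θ q := by
    intro i k
    -- Column operations replace the two integer columns by the errors; the two sign changes cancel.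
    have e : (D i k : ℝ) = det3 (p : ℝ) q r (θ i * p - A i) (θ i * q - B i) (θ i * r - C i)
        (θ k * p - A k) (θ k * q - B k) (θ k * r - C k) := by
      simp only [D, det3]
      push_cast
      ring
    rw [e]
    exact abs_det3_le (by positivity) (by exact_mod_cast hpq.le) (by exact_mod_cast hqr.le)
      h12.le h23.le (abs_sub_round_le_dist3 θ p i) (abs_sub_round_le_dist3 θ p k)
      (abs_sub_round_le_dist3 θ q i) (abs_sub_round_le_dist3 θ q k)
      (abs_sub_round_le_dist3 θ r i) (abs_sub_round_le_dist3 θ r k)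
  by_cases hall : ∀ i k, D i k = 0
  · right
    intro u₀ u hup huq
    obtain ⟨b, hb⟩ := exists_minor_ne_zero hp hpq h12
    have h0 := hall b 0
    have h1 := hall b 1
    have h2 := hall b 2
    simp only [D, det3] at h0 h1 h2
    simp only [evalAt, Fin.sum_univ_three] at hup huq ⊢
    -- After multiplication by the nonzero minor of p and q, the third vector is an integer
    -- combination of the first two.
    refine (mul_eq_zero.mp ?_).resolve_left hb
    linear_combination u 0 * h0 + u 1 * h1 + u 2 * h2 - (q * C b - r * B b) * hup
      + (p * C b - r * A b) * huq
  · left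
    -- These are the cofactors of a 4 × 4 determinant, which vanishes when the row of r is repeated.
    -- Only `u₀` omits the column of denominators, and it needs no bound.
    refine ⟨det3 (A 0) (B 0) (C 0) (A 1) (B 1) (C 1) (A 2) (B 2) (C 2),
      ![-D 1 2, D 0 2, -D 0 1], fun hu => hall ?_, ?_, ?_⟩
    · have h12' : D 1 2 = 0 := by simpa using congrFun hu 0
      have h02 : D 0 2 = 0 := by simpa using congrFun hu 1
      have h01 : D 0 1 = 0 := by simpa using congrFun hu 2
      simp only [D, det3] at h12' h02 h01
      intro i k
      fin_cases i <;> fin_cases k <;>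
        simp only [D, det3, Fin.zero_eta, Fin.mk_one, Fin.reduceFinMk] <;> linarith
    · simp only [evalAt, Fin.sum_univ_three, D, det3, Matrix.cons_val]
      ring
    · intro j
      fin_cases j
      · simpa using hD 1 2
      · simpa using hD 0 2
      · simpa using hD 0 1

/-! ### Best approximations -/

/-- `X` is the sequence of denominators of the best simultaneous approximations to `θ`. -/
structure IsBestSeq (θ : Fin 3 → ℝ) (X : ℕ → ℕ) : Prop where
  zero : X 0 = 1
  strictMono : StrictMono X
  lt : ∀ n, dist3 θ (X (n + 1)) < dist3 θ (X n)
  le : ∀ n q, 1 ≤ q → q < X (n + 1) → dist3 θ (X n) ≤ dist3 θ q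

theorem exists_isBestSeq {θ : Fin 3 → ℝ} (hθ : Independent3 θ) : ∃ X, IsBestSeq θ X := by
  obtain ⟨X, h0, h1, h2, h3⟩ := exists_record_sequence (z := dist3 θ) (fun q hq => by
    obtain ⟨m, hm, hmin⟩ := Finset.exists_min_image (Finset.Icc 1 q) (dist3 θ) ⟨1, by simp [hq]⟩
    obtain ⟨r, hr, hlt⟩ := exists_dist3_lt θ (dist3_pos hθ (Finset.mem_Icc.mp hm).1)
    refine ⟨r, not_le.mp fun hrq => ?_, hlt.trans_le (hmin q (by simp [hq]))⟩
    exact hlt.not_ge (hmin r (Finset.mem_Icc.mpr ⟨hr, hrq⟩)))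
  exact ⟨X, h0, h1, h2, h3⟩

namespace IsBestSeq

variable {θ : Fin 3 → ℝ} {X : ℕ → ℕ}

theorem one_le (hX : IsBestSeq θ X) (n : ℕ) : 1 ≤ X n :=
  hX.zero ▸ hX.strictMono.monotone (Nat.zero_le n)

theorem tendsto (hX : IsBestSeq θ X) : Filter.Tendsto (fun n => (X n : ℝ)) Filter.atTop
    Filter.atTop :=
  tendsto_natCast_atTop_atTop.comp hX.strictMono.tendsto_atTop

theorem exists_dist3_lt (hX : IsBestSeq θ X) {ε : ℝ} (hε : 0 < ε) :
    ∃ N, ∀ n, N ≤ n → dist3 θ (X n) < ε := by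
  obtain ⟨q, hq, hlt⟩ := Diophantine.exists_dist3_lt θ hε
  refine ⟨q, fun n hn => (hX.le n q hq ?_).trans_lt hlt⟩
  exact (Nat.lt_succ_of_le hn).trans_le (hX.strictMono.le_apply)

/-- The best approximations with large indices lie in no proper rational subspace. -/
theorem exists_evalAt_ne_zero (hX : IsBestSeq θ X) (hθ : Independent3 θ) {u₀ : ℤ}
    {u : Fin 3 → ℤ} (hu : ¬ (u₀ = 0 ∧ u = 0)) (N : ℕ) : ∃ n, N ≤ n ∧ evalAt θ u₀ u (X n) ≠ 0 := by
  by_contra! h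
  set η := (u₀ : ℝ) + ∑ j, u j * θ j with hη
  have hη0 : 0 < |η| := abs_pos.mpr fun h0 => hu (hθ u₀ u h0)
  set M : ℝ := ∑ j, |(u j : ℝ)| with hMdef
  have hM : ∀ j, |(u j : ℝ)| ≤ M := fun j =>
    Finset.single_le_sum (f := fun j => |(u j : ℝ)|) (fun i _ => abs_nonneg _) (Finset.mem_univ j)
  have hM0 : 0 ≤ M := (abs_nonneg _).trans (hM 0)
  obtain ⟨K, hK⟩ := hX.exists_dist3_lt (ε := |η| / (3 * M + 1)) (by positivity)
  have hd := hK (max N K) (le_max_right _ _)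
  have h0 := h (max N K) (le_max_left _ _)
  generalize max N K = n at hd h0
  have e := evalAt_cast θ u₀ u (X n)
  rw [h0, Int.cast_zero] at e
  have b := abs_sum_mul_le θ hM (X n)
  rw [← sub_eq_zero.mp e.symm, abs_mul, Nat.abs_cast] at b
  have hX1 : (1 : ℝ) ≤ X n := by exact_mod_cast hX.one_le n
  rw [lt_div_iff₀ (by positivity)] at hd
  have h1 : |η| ≤ |η| * X n := le_mul_of_one_le_right hη0.le hX1
  have h2 := dist3_nonneg θ (X n)
  linarith

/-- Infinitely often three consecutive best approximations are linearly independent. -/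
theorem exists_normal (hX : IsBestSeq θ X) (hθ : Independent3 θ) (N : ℕ) :
    ∃ n, N ≤ n ∧ ∃ (u₀ : ℤ) (u : Fin 3 → ℤ), u ≠ 0 ∧ evalAt θ u₀ u (X (n + 2)) = 0 ∧
      ∀ j, |(u j : ℝ)| ≤ 6 * X (n + 2) * dist3 θ (X n) * dist3 θ (X (n + 1)) := by
  by_contra! h
  have hdep : ∀ n, N ≤ n → ∀ (u₀ : ℤ) (u : Fin 3 → ℤ), evalAt θ u₀ u (X n) = 0 →
      evalAt θ u₀ u (X (n + 1)) = 0 → evalAt θ u₀ u (X (n + 2)) = 0 := by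
    intro n hn
    refine (exists_normal_or_dependent (hX.one_le n) (hX.strictMono n.lt_succ_self)
      (hX.strictMono (n + 1).lt_succ_self) (hX.lt n) (hX.lt (n + 1))).resolve_left ?_
    rintro ⟨u₀, u, hu, h0, hle⟩
    obtain ⟨j, hj⟩ := h n hn u₀ u hu h0
    exact hj.not_ge (hle j)
  let row : ℕ → Fin 4 → ℤ := fun n =>
    ![X n, round (θ 0 * X n), round (θ 1 * X n), round (θ 2 * X n)]
  -- Vanishing at two points is two equations in four unknowns; zero rows pad them to a singular
  -- square matrix. By `hdep` the form then vanishes at every later point.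
  obtain ⟨v, hv, hv0⟩ := (Matrix.exists_mulVec_eq_zero_iff
    (M := (Matrix.of ![row N, row (N + 1), 0, 0] : Matrix (Fin 4) (Fin 4) ℤ))).mpr
    (Matrix.det_eq_zero_of_row_eq_zero 2 fun j => by simp)
  have hrow : ∀ n, evalAt θ (v 0) ![v 1, v 2, v 3] (X n) = row n ⬝ᵥ v := by
    intro n
    simp [evalAt, row, dotProduct, Fin.sum_univ_succ]
    ring
  have hz : ∀ k, evalAt θ (v 0) ![v 1, v 2, v 3] (X (N + k)) = 0 ∧
      evalAt θ (v 0) ![v 1, v 2, v 3] (X (N + k + 1)) = 0 := by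
    intro k
    induction k with
    | zero => exact ⟨(hrow N).trans (congrFun hv0 0), (hrow (N + 1)).trans (congrFun hv0 1)⟩
    | succ k ih => exact ⟨ih.2, hdep (N + k) (by omega) _ _ ih.1 ih.2⟩
  obtain ⟨n, hn, hne⟩ := hX.exists_evalAt_ne_zero hθ (u₀ := v 0) (u := ![v 1, v 2, v 3])
    (fun hcon => hv (by
      have h0 := hcon.1
      have h1 := congrFun hcon.2 0
      have h2 := congrFun hcon.2 1
      have h3 := congrFun hcon.2 2
      funext i
      fin_cases i
      · exact h0
      · exact h1
      · exact h2
      · exact h3)) N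
  obtain ⟨k, rfl⟩ := Nat.exists_eq_add_of_le hn
  exact hne (hz k).1

theorem exists_gap (hX : IsBestSeq θ X) (hθ : Independent3 θ) (N : ℕ) :
    ∃ n i, N ≤ n ∧ n + 2 ≤ i ∧ (X i : ℝ) ≤
      36 * X (n + 2) * dist3 θ (X n) * dist3 θ (X (n + 1)) * dist3 θ (X i) * X (i + 1) := by
  classical
  obtain ⟨n, hn, u₀, u, hu, h0, hle⟩ := hX.exists_normal hθ N
  have hex : ∃ k, evalAt θ u₀ u (X (n + 2 + k)) ≠ 0 := by
    obtain ⟨m, hm, hne⟩ := hX.exists_evalAt_ne_zero hθ (fun h => hu h.2) (n + 2)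
    obtain ⟨k, rfl⟩ := Nat.exists_eq_add_of_le hm
    exact ⟨k, hne⟩
  -- The form vanishes at X (n + 2), so the first failure has a predecessor where it still vanishes.
  obtain ⟨k, hk⟩ : ∃ k, Nat.find hex = k + 1 :=
    Nat.exists_eq_succ_of_ne_zero fun h => Nat.find_spec hex (by rw [h]; exact h0)
  have h1 : evalAt θ u₀ u (X (n + 2 + k + 1)) ≠ 0 := by
    have := Nat.find_spec hex
    rwa [hk] at this
  have h2 : evalAt θ u₀ u (X (n + 2 + k)) = 0 :=
    not_not.mp (Nat.find_min hex (by omega))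
  refine ⟨n, n + 2 + k, hn, by omega, ?_⟩
  have := le_of_evalAt_eq_zero hle (hX.strictMono (Nat.lt_succ_self _)).le (hX.lt _).le h2 h1
  refine this.trans_eq ?_
  rw [Nat.succ_eq_add_one]
  ring

/-- If the best approximations satisfy a uniform bound with exponent `a`, the denominators
infinitely often grow faster than with exponent `g`, for every `g` below the root of
`(1 - a) * x ^ 2 = a * (x + 1)`. -/
theorem exists_rpow_lt (hX : IsBestSeq θ X) (hθ : Independent3 θ) {a g : ℝ} (ha : 0 < a)
    (ha1 : a ≤ 1) (hg : 0 < g) (hag : (1 - a) * g ^ 2 < a * (g + 1)) {N₀ : ℕ}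
    (hL : ∀ n, N₀ ≤ n → dist3 θ (X n) ≤ (X (n + 1) : ℝ) ^ (-a)) (N : ℕ) :
    ∃ n, N ≤ n ∧ (X n : ℝ) ^ g < X (n + 1) := by
  by_contra! h
  -- Otherwise g < (1 - a) g² < a (g + 1), so (1 - a) g < a ≤ 1. The sign permits replacing X i by
  -- the smaller X (n + 2) in `hmono`.
  have hexp : 0 ≤ 1 - (1 - a) * g := by
    by_contra! h1
    nlinarith
  -- The net exponent of X (n + 2) at the end; it is positive by `hag`, and X (n + 2) ^ δ ≤ 36 is
  -- then impossible for large n.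
  set δ := a + a / g - (1 - a) * g with hδ
  have hδ0 : 0 < δ := by
    have : δ = (a * (g + 1) - (1 - a) * g ^ 2) / g := by
      rw [hδ]
      field_simp
    rw [this]
    exact div_pos (by linarith) hg
  obtain ⟨K, hK⟩ := Filter.eventually_atTop.mp
    (((tendsto_rpow_atTop hδ0).comp hX.tendsto).eventually_gt_atTop 36)
  obtain ⟨n, i, hn, hi, hgap⟩ := hX.exists_gap hθ (max N₀ (max N K))
  have hn0 : N₀ ≤ n := (le_max_left _ _).trans hn
  have hnN : N ≤ n := (le_max_left _ _).trans ((le_max_right _ _).trans hn)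
  have hnK : K ≤ n := (le_max_right _ _).trans ((le_max_right _ _).trans hn)
  have hpos : ∀ m, (0 : ℝ) < X m := fun m => by exact_mod_cast hX.one_le m
  have h1i : (1 : ℝ) ≤ X (n + 2) := by exact_mod_cast hX.one_le _
  have hL0 := hL n hn0
  have hL1 := hL (n + 1) (by omega)
  have hLi := hL i (by omega)
  have hgi : (X (i + 1) : ℝ) ^ (1 - a) ≤ (X i : ℝ) ^ ((1 - a) * g) := by
    rw [mul_comm, Real.rpow_mul (hpos i).le]
    exact Real.rpow_le_rpow (hpos _).le (h i (by omega)) (by linarith)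
  have hgn : (X (n + 1) : ℝ) ^ (-a) ≤ (X (n + 2) : ℝ) ^ (-(a / g)) := by
    have h2 : (X (n + 2) : ℝ) ^ (a / g) ≤ (X (n + 1) : ℝ) ^ a := by
      calc (X (n + 2) : ℝ) ^ (a / g) ≤ ((X (n + 1) : ℝ) ^ g) ^ (a / g) :=
            Real.rpow_le_rpow (hpos _).le (h (n + 1) (by omega)) (by positivity)
        _ = (X (n + 1) : ℝ) ^ a := by
            rw [← Real.rpow_mul (hpos _).le, mul_div_cancel₀ _ hg.ne']
    rw [Real.rpow_neg (hpos _).le, Real.rpow_neg (hpos _).le]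
    exact inv_anti₀ (Real.rpow_pos_of_pos (hpos _) _) h2
  have hprod : ∀ m, (X m : ℝ) ^ (-a) * X m = (X m : ℝ) ^ (1 - a) := fun m => by
    rw [← Real.rpow_add_one (hpos m).ne']
    ring_nf
  have hbound : (X i : ℝ) ≤ 36 * (X (n + 2) : ℝ) ^ (1 - a - a / g) * (X i : ℝ) ^ ((1 - a) * g) := by
    calc (X i : ℝ) ≤ 36 * X (n + 2) * dist3 θ (X n) * dist3 θ (X (n + 1)) * dist3 θ (X i)
          * X (i + 1) := hgap
      _ ≤ 36 * X (n + 2) * (X (n + 2) : ℝ) ^ (-(a / g)) * (X (n + 2) : ℝ) ^ (-a)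
          * (X (i + 1) : ℝ) ^ (-a) * X (i + 1) := by
          have := dist3_nonneg θ
          gcongr
          · exact this _
          · exact this _
          · exact hL0.trans hgn
      _ = 36 * ((X (n + 2) : ℝ) ^ (-a) * X (n + 2) * (X (n + 2) : ℝ) ^ (-(a / g)))
          * ((X (i + 1) : ℝ) ^ (-a) * X (i + 1)) := by ring
      _ = 36 * (X (n + 2) : ℝ) ^ (1 - a - a / g) * (X (i + 1) : ℝ) ^ (1 - a) := by
          rw [hprod, hprod, ← Real.rpow_add (hpos _), ← sub_eq_add_neg]
      _ ≤ _ := by gcongr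
  have hdiv : (X i : ℝ) ^ (1 - (1 - a) * g) ≤ 36 * (X (n + 2) : ℝ) ^ (1 - a - a / g) := by
    rw [Real.rpow_sub (hpos i), Real.rpow_one, div_le_iff₀ (Real.rpow_pos_of_pos (hpos i) _)]
    exact hbound
  have hmono : (X (n + 2) : ℝ) ^ (1 - (1 - a) * g) ≤ (X i : ℝ) ^ (1 - (1 - a) * g) :=
    Real.rpow_le_rpow (hpos _).le (by exact_mod_cast hX.strictMono.monotone hi) hexp
  have hfin : (X (n + 2) : ℝ) ^ δ ≤ 36 := by
    have : δ = (1 - (1 - a) * g) - (1 - a - a / g) := by rw [hδ]; ring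
    rw [this, Real.rpow_sub (hpos _), div_le_iff₀ (Real.rpow_pos_of_pos (hpos _) _)]
    exact hmono.trans hdiv
  exact (hK (n + 2) (by omega)).not_ge hfin

end IsBestSeq

/-! ### The exponents -/

/-- The gap between a and γ absorbs both the limsup bound and the factor 2, which is used when
passing to best approximations. -/
theorem eventually_psi_le (θ : Fin 3 → ℝ) {a γ : ℝ} (haγ : a < γ)
    (h : Filter.limsup (fun t : ℝ => ((t ^ γ * psi !![θ 0; θ 1; θ 2] t : ℝ) : EReal))
      Filter.atTop < ⊤) :
    ∀ᶠ t : ℝ in Filter.atTop, psi !![θ 0; θ 1; θ 2] t ≤ (2 * t) ^ (-a) := by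
  obtain ⟨b, hb, -⟩ := EReal.lt_iff_exists_real_btwn.mp h
  filter_upwards [Filter.eventually_lt_of_limsup_lt hb, Filter.eventually_ge_atTop 1,
    (tendsto_rpow_atTop (sub_pos.mpr haγ)).eventually_ge_atTop ((|b| + 1) * 2 ^ a)]
    with t ht ht1 htB
  have ht0 : 0 < t := by linarith
  have ht' : t ^ γ * psi !![θ 0; θ 1; θ 2] t < b := by exact_mod_cast ht
  have hψ := psi_nonneg θ ht1
  have hta : 0 < t ^ a := Real.rpow_pos_of_pos ht0 a
  have h2a : (0 : ℝ) < 2 ^ a := Real.rpow_pos_of_pos two_pos a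
  have hsplit : t ^ γ = t ^ (γ - a) * t ^ a := by rw [← Real.rpow_add ht0, sub_add_cancel]
  have hle : (|b| + 1) * (2 ^ a * t ^ a * psi !![θ 0; θ 1; θ 2] t) ≤ (|b| + 1) * 1 := by
    calc (|b| + 1) * (2 ^ a * t ^ a * psi !![θ 0; θ 1; θ 2] t)
        = (|b| + 1) * 2 ^ a * (t ^ a * psi !![θ 0; θ 1; θ 2] t) := by ring
      _ ≤ t ^ (γ - a) * (t ^ a * psi !![θ 0; θ 1; θ 2] t) := by gcongr
      _ = t ^ γ * psi !![θ 0; θ 1; θ 2] t := by rw [hsplit]; ring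
      _ ≤ (|b| + 1) * 1 := by linarith [le_abs_self b]
  have h1 := le_of_mul_le_mul_left hle (by positivity)
  rw [Real.rpow_neg (by positivity), Real.mul_rpow two_pos.le ht0.le, ← one_div,
    le_div_iff₀ (by positivity)]
  linarith

/-- `psi` is evaluated at X (n + 1) - 1, before the next record lowers it; there 2 * t ≥ X (n + 1),
since X (n + 1) ≥ 2. -/
theorem IsBestSeq.exists_dist3_le_rpow {θ : Fin 3 → ℝ} {X : ℕ → ℕ} (hX : IsBestSeq θ X) {a : ℝ}
    (ha : 0 < a) (h : ∀ᶠ t : ℝ in Filter.atTop, psi !![θ 0; θ 1; θ 2] t ≤ (2 * t) ^ (-a)) :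
    ∃ N, ∀ n, N ≤ n → dist3 θ (X n) ≤ (X (n + 1) : ℝ) ^ (-a) := by
  have htend : Filter.Tendsto (fun n => (X (n + 1) : ℝ) - 1) Filter.atTop Filter.atTop :=
    Filter.tendsto_atTop_add_const_right _ _ (hX.tendsto.comp (Filter.tendsto_add_atTop_nat 1))
  obtain ⟨N, hN⟩ := Filter.eventually_atTop.mp (htend.eventually h)
  refine ⟨N, fun n hn => ?_⟩
  have h2 : (2 : ℝ) ≤ X (n + 1) := by
    have := hX.strictMono (Nat.lt_add_one n)
    have := hX.one_le n
    exact_mod_cast (by omega : 2 ≤ X (n + 1))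
  calc dist3 θ (X n) ≤ psi !![θ 0; θ 1; θ 2] ((X (n + 1) : ℝ) - 1) := by
        refine le_psi θ (by linarith) fun q hq hqt => hX.le n q hq ?_
        have : (q : ℝ) < X (n + 1) := by linarith
        exact_mod_cast this
    _ ≤ (2 * ((X (n + 1) : ℝ) - 1)) ^ (-a) := hN n hn
    _ ≤ (X (n + 1) : ℝ) ^ (-a) :=
        Real.rpow_le_rpow_of_nonpos (by linarith) (by linarith) (by linarith)

theorem one_third_le_uniformExponent (θ : Fin 3 → ℝ) :
    ((1 / 3 : ℝ) : EReal) ≤ uniformExponent !![θ 0; θ 1; θ 2] := by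
  refine le_sSup ⟨1 / 3, ⟨by norm_num, ?_⟩, rfl⟩
  refine lt_of_le_of_lt (Filter.limsup_le_of_le (a := ((2 : ℝ) : EReal)) (by isBoundedDefault) ?_)
    (EReal.coe_lt_top 2)
  filter_upwards [Filter.eventually_ge_atTop 1] with t ht
  exact_mod_cast psi_le_of_one_le θ ht

/-- An exponent a > 1 would give 1 ≤ 2 X (n + 1) ^ (1 - a), which tends to 0. -/
theorem uniformExponent_le_one {θ : Fin 3 → ℝ} (hθ : Independent3 θ) :
    uniformExponent !![θ 0; θ 1; θ 2] ≤ ((1 : ℝ) : EReal) := by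
  refine sSup_le ?_
  rintro _ ⟨γ, ⟨-, hγ⟩, rfl⟩
  refine EReal.coe_le_coe_iff.mpr (not_lt.mp fun hlt => ?_)
  obtain ⟨a, ha1, haγ⟩ := exists_between hlt
  obtain ⟨X, hX⟩ := exists_isBestSeq hθ
  obtain ⟨N, hN⟩ := hX.exists_dist3_le_rpow (by linarith) (eventually_psi_le θ haγ hγ)
  obtain ⟨K, hK⟩ := Filter.eventually_atTop.mp
    (((tendsto_rpow_atTop (sub_pos.mpr ha1)).comp hX.tendsto).eventually_gt_atTop 2)
  have hL := hN (max N K) (le_max_left _ _)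
  have hbig : 2 < (X (max N K + 1) : ℝ) ^ (a - 1) := hK _ ((le_max_right _ _).trans (Nat.le_succ _))
  generalize max N K = n at hL hbig
  have hone := one_le_two_mul_dist3 (hX.one_le n) (hX.strictMono n.lt_succ_self) (hX.lt n)
  have hpos : (0 : ℝ) < X (n + 1) := by exact_mod_cast hX.one_le (n + 1)
  have hle : 1 ≤ 2 * (X (n + 1) : ℝ) ^ (-(a - 1)) := by
    calc 1 ≤ 2 * (X (n + 1) : ℝ) * dist3 θ (X n) := hone
      _ ≤ 2 * (X (n + 1) : ℝ) * (X (n + 1) : ℝ) ^ (-a) := by gcongr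
      _ = 2 * ((X (n + 1) : ℝ) ^ (-a) * X (n + 1)) := by ring
      _ = 2 * (X (n + 1) : ℝ) ^ (-(a - 1)) := by
          rw [← Real.rpow_add_one hpos.ne']
          ring_nf
  rw [Real.rpow_neg hpos.le, ← div_eq_mul_inv, le_div_iff₀ (by positivity)] at hle
  linarith

/-- A lower bound for the individual exponent from a uniform bound. -/
theorem mul_le_individualExponent {θ : Fin 3 → ℝ} (hθ : Independent3 θ) {a g : ℝ} (ha : 0 < a)
    (ha1 : a ≤ 1) (hg : 0 < g) (hag : (1 - a) * g ^ 2 < a * (g + 1))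
    (hlt : (a : EReal) < uniformExponent !![θ 0; θ 1; θ 2]) :
    ((a * g : ℝ) : EReal) ≤ individualExponent !![θ 0; θ 1; θ 2] := by
  obtain ⟨_, ⟨γ, ⟨-, hγ⟩, rfl⟩, haγ⟩ := lt_sSup_iff.mp hlt
  obtain ⟨X, hX⟩ := exists_isBestSeq hθ
  obtain ⟨N₀, hN₀⟩ := hX.exists_dist3_le_rpow ha
    (eventually_psi_le θ (EReal.coe_lt_coe_iff.mp haγ) hγ)
  refine le_sSup ⟨a * g, ⟨by positivity, ?_⟩, rfl⟩
  refine lt_of_le_of_lt (Filter.liminf_le_of_frequently_le' (x := ((1 : ℝ) : EReal)) ?_)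
    (EReal.coe_lt_top 1)
  refine Filter.frequently_atTop.mpr fun T => ?_
  obtain ⟨K, hK⟩ := Filter.eventually_atTop.mp (hX.tendsto.eventually_ge_atTop T)
  obtain ⟨n, hn, hlt'⟩ := hX.exists_rpow_lt hθ ha ha1 hg hag hN₀ (max N₀ K)
  refine ⟨X n, hK n ((le_max_right _ _).trans hn), EReal.coe_le_coe_iff.mpr ?_⟩
  have hpos : (0 : ℝ) < X n := by exact_mod_cast hX.one_le n
  have hg0 : 0 < (X n : ℝ) ^ g := Real.rpow_pos_of_pos hpos g
  calc (X n : ℝ) ^ (a * g) * psi !![θ 0; θ 1; θ 2] (X n)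
      ≤ (X n : ℝ) ^ (a * g) * ((X n : ℝ) ^ g) ^ (-a) := by
        gcongr
        calc psi !![θ 0; θ 1; θ 2] (X n) ≤ dist3 θ (X n) := psi_le_dist3 θ (hX.one_le n) le_rfl
          _ ≤ (X (n + 1) : ℝ) ^ (-a) := hN₀ n ((le_max_left _ _).trans hn)
          _ ≤ ((X n : ℝ) ^ g) ^ (-a) :=
              Real.rpow_le_rpow_of_nonpos hg0 hlt'.le (by linarith)
    _ = 1 := by
        rw [← Real.rpow_mul hpos.le, ← Real.rpow_add hpos]
        ring_nf
        exact Real.rpow_zero _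

/-- α itself need not be an admissible exponent, so g is fixed below g₁(α) and a is moved slightly
below α; the strict inequalities survive by continuity. -/
theorem mul_g1_le_individualExponent {θ : Fin 3 → ℝ} (hθ : Independent3 θ) {α : ℝ}
    (hα : uniformExponent !![θ 0; θ 1; θ 2] = (α : EReal)) (h3 : 1 / 3 ≤ α) (h1 : α ≤ 1) :
    ((α * g1 α : ℝ) : EReal) ≤ individualExponent !![θ 0; θ 1; θ 2] := by
  by_contra! hcon
  obtain ⟨b, hb, hbα⟩ := EReal.lt_iff_exists_real_btwn.mp hcon
  have hα0 : 0 < α := by linarith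
  have hbα' : b / α < g1 α := by
    rw [div_lt_iff₀ hα0, mul_comm]
    exact_mod_cast hbα
  -- The maximum with 0 keeps g positive when b is negative.
  obtain ⟨g, hg, hgg⟩ := exists_between (max_lt hbα' (g1_pos hα0))
  obtain ⟨hbg, hg0⟩ := max_lt_iff.mp hg
  have hbg' : b < α * g := by rwa [div_lt_iff₀ hα0, mul_comm] at hbg
  have hq := quadratic_lt_of_lt_g1 h3 h1 hg0 hgg
  have hc1 : ∀ᶠ a in nhds α, b < a * g :=
    (Continuous.tendsto (by fun_prop : Continuous fun a : ℝ => a * g) α).eventually_const_lt hbg'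
  have hc2 : ∀ᶠ a in nhds α, (1 - a) * g ^ 2 < a * (g + 1) :=
    (isOpen_lt (by fun_prop : Continuous fun a : ℝ => (1 - a) * g ^ 2)
      (by fun_prop : Continuous fun a : ℝ => a * (g + 1))).mem_nhds hq
  obtain ⟨a, ⟨⟨ha1, ha2⟩, ha3⟩, ha⟩ := (((hc1.and hc2).and (lt_mem_nhds hα0)).filter_mono
    nhdsWithin_le_nhds |>.and (self_mem_nhdsWithin (s := Set.Iio α))).exists
  have ha' : a < α := ha
  have := mul_le_individualExponent hθ ha3 (ha'.le.trans h1) hg0 ha2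
    (by rw [hα]; exact_mod_cast ha')
  exact absurd ((EReal.coe_lt_coe_iff.mpr ha1).trans_le this) hb.le.not_gt

theorem exists_uniformExponent_eq {θ : Fin 3 → ℝ} (hθ : Independent3 θ) :
    ∃ α : ℝ, uniformExponent !![θ 0; θ 1; θ 2] = (α : EReal) ∧ 1 / 3 ≤ α ∧ α ≤ 1 := by
  have hlow := one_third_le_uniformExponent θ
  have hup := uniformExponent_le_one hθ
  have e := EReal.coe_toReal (hup.trans_lt (EReal.coe_lt_top 1)).ne
    ((EReal.bot_lt_coe _).trans_le hlow).ne'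
  rw [← e] at hlow hup
  exact ⟨_, e.symm, EReal.coe_le_coe_iff.mp hlow, EReal.coe_le_coe_iff.mp hup⟩

end Diophantine

theorem theorem2 :
    -- `g₁(a)` is the largest root of the quadratic equation
    (∀ a : ℝ, 0 < a →
      IsGreatest {x : ℝ | (2 * a ^ 2 - 2 * a + 1) * x ^ 2 + a * (a - 1) * x - a = 0}
        (Diophantine.g1 a)) ∧
    -- `α(Θ)` is a real number in `[1/3, 1]`, and `β(Θ) ≥ α(Θ) g₁(α(Θ))`
    (∀ θ₁ θ₂ θ₃ : ℝ, LinearIndependent ℤ ![1, θ₁, θ₂, θ₃] →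
      (∀ t : ℝ, 1 ≤ t → 0 < Diophantine.psi !![θ₁; θ₂; θ₃] t) ∧
      ∃ α : ℝ, Diophantine.uniformExponent !![θ₁; θ₂; θ₃] = (α : EReal) ∧
        1 / 3 ≤ α ∧ α ≤ 1 ∧
        ((α * Diophantine.g1 α : ℝ) : EReal) ≤
          Diophantine.individualExponent !![θ₁; θ₂; θ₃]) ∧
    -- the bound is better than `α² / (1 - α)` for `1/3 < α < α₀`
    (∃ α₀ : ℝ, (∀ x : ℝ, x ^ 3 - x ^ 2 + 2 * x - 1 = 0 ↔ x = α₀) ∧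
      1 / 3 < α₀ ∧ α₀ < 1 ∧
      ∀ a : ℝ, 1 / 3 < a → a < α₀ → a ^ 2 / (1 - a) < a * Diophantine.g1 a) := by
  refine ⟨fun a ha => Diophantine.isGreatest_g1 ha, fun θ₁ θ₂ θ₃ h => ?_,
    Diophantine.exists_cubic_root⟩
  have hθ := Diophantine.independent3_of_linearIndependent h
  obtain ⟨α, hα, h3, h1⟩ := Diophantine.exists_uniformExponent_eq hθ
  exact ⟨fun t ht => Diophantine.psi_pos hθ ht, α, hα, h3, h1,
    Diophantine.mul_g1_le_individualExponent hθ hα h3 h1⟩
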